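/- **Setting.** An instance is a pair $(X,O)$, where $X\subset\mathbb{R}^m$ is a finite set of $n$ points and $O:X\to\{1,\dots,k\}$ is a label oracle; its latent clustering is $\mathcal{C}=(C_1,\dots,C_k)$ with $C_i=\{x\in X: O(x)=i\}$ (clusters may be empty). A (randomized) algorithm knows $k$ and $X$, queries $O$ adaptively on points of $X$, and outputs a clustering of $X$. The clustering $\mathcal{C}$ has one-versus-all margin $\gamma$ if for every $i$ $$d(X\setminus C_i,\,C_i)>\gamma\,\phi(C_i),$$ where $d$ is the Euclidean distance between sets ($\infty$ if one of them is empty) and $\phi$ the Euclidean diameter ($\phi(\emptyset)=0$). It is realized by a family $\mathcal{H}$ of subsets of $\mathbb{R}^m$ (a concept class) if for every $i$ there is $h_i\in\mathcal{H}$ with $C_i=X\cap h_i$. The class $\mathcal{H}$ is non-fractal if some $h\in\mathcal{H}$ is such that both $h$ and its complement contain a ball of positive radius; it is closed under affine transformations if $f(h)\in\mathcal{H}$ for all $h\in\mathcal{H}$ and all invertible affine maps $f$ of $\mathbb{R}^m$. **Theorem.** There are constants $K_a$ (depending only on $a>0$) and a universal constant $c>0$ such that, for every $m$ and every concept class $\mathcal{H}$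 in $\mathbb{R}^m$ that is non-fractal and closed under affine transformations, the following hold. 1. For every $k$ and every $\gamma>0$ there is a randomized algorithm that, on every instance whose latent clustering $\mathcal{C}$ has one-versus-all margin $\gamma$ and is realized by $\mathcal{H}$, always returns $\mathcal{C}$, and that for every $a>0$ makes, with probability at least $1-n^{-a}$, at most $$K_a\,M\,k\,\log k\,\log n,\qquad M=\max\bigl(2,(1+4/\gamma)^m\bigr),$$ queries. 2. Suppose $m\ge 2$ and $k\ge 2$. Let $\mathcal{A}$ be any randomized algorithm and let $0<p\le 1$. For every $N$ and every $\varepsilon>0$ there is a finite set $X\subset\mathbb{R}^m$ of $n\ge N$ points such that the following holds, where $\mathcal{S}$ is the set of all instances $(X,O)$ on $X$ whose latent clustering is realized by $\mathcal{H}$, has some positive one-versus-all margin, and does not have one-versus-all margin $\varepsilon$: if $\mathcal{A}$ returns the latent clustering with probability at least $p$ on every instance in $\mathcal{S}$, then on some instance in $\mathcal{S}$ it makes at least $c\,p\,n$ queries in expectation. -/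

import Mathlib

open scoped ENNReal

namespace ClusterRecovery

/-- A deterministic adaptive label-query algorithm on the point set `α` with labels `Fin k`: it
either stops and outputs a labelling of all points, or it queries the label of a point and continues
in a way that depends on the answer. -/
inductive QueryTree (α : Type) (k : ℕ) : Type
  | output (C : α → Fin k) : QueryTree α k
  | query (x : α) (next : Fin k → QueryTree α k) : QueryTree α k

/-- The labelling returned when the queries are answered by the oracle `O`. -/
def QueryTree.result {α : Type} {k : ℕ} (O : α → Fin k) : QueryTree α k → (α → Fin k)
  | .output C => C
  | .query x next => (next (O x)).result O

/-- The number of queries made when the queries are answered by the oracle `O`. -/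
def QueryTree.numQueries {α : Type} {k : ℕ} (O : α → Fin k) : QueryTree α k → ℕ
  | .output _ => 0
  | .query x next => (next (O x)).numQueries O + 1

/-- A randomized label-query algorithm for `k` clusters over the domain `𝒳`: it receives the finite
point set `X`, tosses its coins, and runs a deterministic adaptive query algorithm on `X`. -/
def Algorithm (𝒳 : Type) (k : ℕ) : Type :=
  (X : Finset 𝒳) → PMF (QueryTree X k)

section Algorithm

variable {𝒳 : Type} {k : ℕ}

/-- The algorithm outputs the latent clustering of the instance `(X, O)` for every outcome of its
coin tosses. -/
def Algorithm.AlwaysRecovers (A : Algorithm 𝒳 k) (X : Finset 𝒳) (O : X → Fin k) : Prop :=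
  ∀ T ∈ (A X).support, T.result O = O

/-- The probability that the algorithm outputs the latent clustering of the instance `(X, O)`. -/
noncomputable def Algorithm.successProb (A : Algorithm 𝒳 k) (X : Finset 𝒳) (O : X → Fin k) :
    ℝ≥0∞ :=
  (A X).toOuterMeasure {T | T.result O = O}

/-- The probability that the algorithm makes at most `q` queries on the instance `(X, O)`. -/
noncomputable def Algorithm.probQueriesLE (A : Algorithm 𝒳 k) (X : Finset 𝒳) (O : X → Fin k)
    (q : ℝ) : ℝ≥0∞ :=
  (A X).toOuterMeasure {T | (T.numQueries O : ℝ) ≤ q}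

/-- The expected number of queries made by the algorithm on the instance `(X, O)`. -/
noncomputable def Algorithm.expectedQueries (A : Algorithm 𝒳 k) (X : Finset 𝒳) (O : X → Fin k) :
    ℝ≥0∞ :=
  ∑' T : QueryTree X k, A X T * (T.numQueries O : ℝ≥0∞)

end Algorithm

section Clustering

variable {𝒳 : Type} {k : ℕ}

/-- The `i`-th cluster of the latent clustering of an instance `(X, O)`. Tuples `(C₁, …, C_k)` of
pairwise disjoint, possibly empty sets with union `X` correspond exactly to labellings `O` of `X`. -/
def cluster {X : Finset 𝒳} (O : X → Fin k) (i : Fin k) : Set 𝒳 :=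
  {x | ∃ hx : x ∈ X, O ⟨x, hx⟩ = i}

/-- The clustering is realized by the concept class `H`. -/
def RealizedBy (H : Set (Set 𝒳)) {X : Finset 𝒳} (O : X → Fin k) : Prop :=
  ∀ i : Fin k, ∃ h ∈ H, cluster O i = (X : Set 𝒳) ∩ h

/-- The diameter of `S` measured by `d`; it is `0` for the empty set. -/
noncomputable def diameter (d : 𝒳 → 𝒳 → ℝ) (S : Set 𝒳) : ℝ≥0∞ :=
  ⨆ x ∈ S, ⨆ y ∈ S, ENNReal.ofReal (d x y)

/-- The distance of two sets measured by `d`; it is `∞` if one of them is empty. -/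
noncomputable def setDist (d : 𝒳 → 𝒳 → ℝ) (U S : Set 𝒳) : ℝ≥0∞ :=
  ⨅ x ∈ U, ⨅ y ∈ S, ENNReal.ofReal (d x y)

/-- The clustering has one-versus-all margin `γ` with respect to the pseudometrics `d₁, …, d_k`. -/
def HasOVAMargin (d : Fin k → 𝒳 → 𝒳 → ℝ) (γ : ℝ) {X : Finset 𝒳} (O : X → Fin k) : Prop :=
  ∀ i : Fin k, ENNReal.ofReal γ * diameter (d i) (cluster O i) <
    setDist (d i) ((X : Set 𝒳) \ cluster O i) (cluster O i)

end Clustering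

/-- One-versus-all margin `γ` in `ℝᵐ`, all pseudometrics being the Euclidean metric. -/
def HasEuclideanMargin {m k : ℕ} (γ : ℝ) {X : Finset (EuclideanSpace ℝ (Fin m))}
    (O : X → Fin k) : Prop :=
  HasOVAMargin (fun _ x y => dist x y) γ O

/-- Some concept and its complement both contain a ball of positive radius. -/
def NonFractal {m : ℕ} (H : Set (Set (EuclideanSpace ℝ (Fin m)))) : Prop :=
  ∃ h ∈ H, (∃ c, ∃ r > 0, Metric.ball c r ⊆ h) ∧ (∃ c, ∃ r > 0, Metric.ball c r ⊆ hᶜ)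

/-- Closure under (invertible) affine transformations. -/
def ClosedUnderAffine {m : ℕ} (H : Set (Set (EuclideanSpace ℝ (Fin m)))) : Prop :=
  ∀ f : EuclideanSpace ℝ (Fin m) ≃ᵃ[ℝ] EuclideanSpace ℝ (Fin m), ∀ h ∈ H, f '' h ∈ H

/-- `M = max(2, (1 + 4/γ)^m)`. -/
noncomputable def packingBound (m : ℕ) (γ : ℝ) : ℝ :=
  max 2 ((1 + 4 / γ) ^ m)

end ClusterRecovery

open ClusterRecovery

open scoped ENNReal

/-! Upper bound. Under margin `γ`, a point has the label of a sampled point as soon as their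
distance is at most `γ` times the diameter of the sampled points with that label: the sample forces
the label. In any finite family, a volume argument (`card_le_of_forall_extreme`) leaves at most `(1
+ 4 / γ) ^ m + 1` members of each cluster unforced by the others, hence at most `B = extremeBound m
k γ` in all, however large the family. By exchangeability (`leave_one_out`), `2 * B` uniform sample
points leave on average at most half of the points unforced. Repeating this on the rest, a run needs
more than `t` rounds with probability at most `n / 2 ^ t`. Forced labels are certain, so the output
is always correct.

Lower bound. On the unit sphere, a ball around `-x` of radius slightly less than `2` contains any
finite set of points other than `x`. As a concept and its complement both contain a ball, similar
copies of the concept realize the clustering into `{x}` and the rest. Until `x` is queried all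
answers agree, so finding `x` is a needle search that costs order `p * n` queries for success
probability `p`. Placing points close to each other together with their antipodes destroys margin
`ε`. -/

namespace ClusterRecovery

/-! ### Packing bounds -/

open MeasureTheory Module in
/-- Volume bound for `δ`-separated families in a ball of radius `ρ`. -/
lemma card_le_of_separated_of_mem_closedBall {ι E : Type*} [NormedAddCommGroup E]
    [NormedSpace ℝ E] [FiniteDimensional ℝ E] (J : Finset ι) (f : ι → E) (c : E) {ρ δ : ℝ}
    (hρ : 0 ≤ ρ) (hδ : 0 < δ) (hball : ∀ i ∈ J, dist (f i) c ≤ ρ)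
    (hsep : ∀ i ∈ J, ∀ j ∈ J, i ≠ j → δ ≤ dist (f i) (f j)) :
    (J.card : ℝ) ≤ (1 + 2 * ρ / δ) ^ finrank ℝ E := by
  borelize E
  let μ : Measure E := Measure.addHaar
  have hδ2 : 0 < δ / 2 := by positivity
  have hR : 0 < ρ + δ / 2 := by positivity
  have hdisj : (J : Set ι).PairwiseDisjoint fun i => Metric.ball (f i) (δ / 2) := by
    intro i hi j hj hij
    apply Metric.ball_disjoint_ball
    have := hsep i hi j hj hij
    linarith
  have hsub : (⋃ i ∈ J, Metric.ball (f i) (δ / 2)) ⊆ Metric.ball c (ρ + δ / 2) := by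
    refine Set.iUnion₂_subset fun i hi => Metric.ball_subset_ball' ?_
    have := hball i hi
    linarith
  have hvol : (J.card : ℝ≥0∞) * ENNReal.ofReal ((δ / 2) ^ finrank ℝ E) * μ (Metric.ball 0 1) ≤
      ENNReal.ofReal ((ρ + δ / 2) ^ finrank ℝ E) * μ (Metric.ball 0 1) := by
    calc _ = μ (⋃ i ∈ J, Metric.ball (f i) (δ / 2)) := by
          rw [measure_biUnion_finset hdisj fun i _ => measurableSet_ball]
          simp only [μ.addHaar_ball_of_pos _ hδ2, Finset.sum_const, nsmul_eq_mul, mul_assoc]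
      _ ≤ μ (Metric.ball c (ρ + δ / 2)) := measure_mono hsub
      _ = _ := μ.addHaar_ball_of_pos _ hR
  have hvol' := (ENNReal.mul_le_mul_iff_left
    (Metric.measure_ball_pos μ _ zero_lt_one).ne' measure_ball_lt_top.ne).1 hvol
  have hreal : (J.card : ℝ) * (δ / 2) ^ finrank ℝ E ≤ (ρ + δ / 2) ^ finrank ℝ E := by
    have := ENNReal.toReal_le_of_le_ofReal (by positivity) hvol'
    rwa [ENNReal.toReal_mul, ENNReal.toReal_natCast, ENNReal.toReal_ofReal (by positivity)] at this
  rw [← le_div_iff₀ (by positivity), ← div_pow] at hreal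
  have heq : (ρ + δ / 2) / (δ / 2) = 1 + 2 * ρ / δ := by
    field_simp
    ring
  rwa [heq] at hreal

/-- A family in which every member is farther than `γ` times the diameter of the other members
from each of them has at most `(1 + 4 / γ) ^ m + 1` members. -/
lemma card_le_of_forall_extreme {ι : Type*} {m : ℕ} {γ : ℝ} (hγ : 0 < γ) (J : Finset ι)
    (f : ι → EuclideanSpace ℝ (Fin m))
    (h : ∀ j ∈ J, ∀ a ∈ J, ∀ b ∈ J, ∀ c ∈ J, a ≠ j → b ≠ j → c ≠ j →
      γ * dist (f b) (f c) < dist (f j) (f a)) :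
    (J.card : ℝ) ≤ (1 + 4 / γ) ^ m + 1 := by
  classical
  have hone : (0 : ℝ) ≤ (1 + 4 / γ) ^ m := by positivity
  rcases le_or_gt J.card 1 with hJ | hJ
  · have : (J.card : ℝ) ≤ 1 := by exact_mod_cast hJ
    linarith
  obtain ⟨u, hu, v, hv, huv⟩ := Finset.one_lt_card.1 hJ
  obtain ⟨⟨a, b⟩, hab, hmax⟩ := (J ×ˢ J).exists_max_image (fun q => dist (f q.1) (f q.2))
    ⟨(u, v), Finset.mk_mem_product hu hv⟩
  obtain ⟨ha, hb⟩ := Finset.mem_product.1 hab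
  -- The hypothesis with `b = c` separates distinct members.
  have hρ : 0 < dist (f a) (f b) := by
    have h1 := h u hu v hv v hv v hv huv.symm huv.symm huv.symm
    have h2 := hmax (u, v) (Finset.mk_mem_product hu hv)
    simp only [dist_self, mul_zero] at h1
    exact h1.trans_le h2
  -- Without the endpoint `a` of a diametral pair, one of any two distinct members lies outside the
  -- pair `a`, `b`, so its distance to the other one exceeds `γ` times the diameter.
  have key := card_le_of_separated_of_mem_closedBall (J.erase a) f (f b) hρ.le
    (mul_pos hγ hρ)
    (fun i hi => hmax (i, b) (Finset.mk_mem_product (Finset.mem_of_mem_erase hi) hb)) (by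
      intro i hi j hj hij
      obtain ⟨hia, hi⟩ := Finset.mem_erase.1 hi
      obtain ⟨hja, hj⟩ := Finset.mem_erase.1 hj
      by_cases hib : i = b
      · rw [dist_comm (f i)]
        exact (h j hj i hi a ha b hb hij (Ne.symm hja) (fun e => hij (hib.trans e))).le
      · exact (h i hi j hj a ha b hb (Ne.symm hij) (Ne.symm hia) (Ne.symm hib)).le)
  rw [finrank_euclideanSpace_fin, Finset.card_erase_of_mem ha,
    Nat.cast_sub (by omega), Nat.cast_one] at key
  have hle : (1 + 2 * dist (f a) (f b) / (γ * dist (f a) (f b))) ^ m ≤ (1 + 4 / γ) ^ m := by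
    have : 2 * dist (f a) (f b) / (γ * dist (f a) (f b)) = 2 / γ := by field_simp
    rw [this]
    gcongr
    norm_num
  linarith

/-! ### Averaging and couplings -/

/-- Leave-one-out: if among any `s + 1` points at most `B` are bad given the other ones, then
a random point is bad given `s` random points with probability at most `B / (s + 1)`. -/
lemma leave_one_out {β : Type*} [Fintype β] (s B : ℕ) (bad : (Fin s → β) → β → Prop)
    [∀ w, DecidablePred (bad w)]
    (h : ∀ z : Fin (s + 1) → β,
      (Finset.univ.filter fun j => bad (j.removeNth z) (z j)).card ≤ B) :
    (s + 1) * ∑ w, (Finset.univ.filter (bad w)).card ≤ B * Fintype.card β ^ (s + 1) := by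
  classical
  have hj : ∀ j : Fin (s + 1), ∑ z : Fin (s + 1) → β, (if bad (j.removeNth z) (z j) then 1 else 0)
      = ∑ w, (Finset.univ.filter (bad w)).card := by
    intro j
    rw [← (Fin.insertNthEquiv (fun _ => β) j).sum_comp, Fintype.sum_prod_type_right]
    refine Finset.sum_congr rfl fun w _ => ?_
    rw [Finset.card_filter]
    refine Finset.sum_congr rfl fun y _ => ?_
    simp [Fin.insertNthEquiv]
  calc (s + 1) * ∑ w, (Finset.univ.filter (bad w)).card
      = ∑ j : Fin (s + 1), ∑ z : Fin (s + 1) → β,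
          (if bad (j.removeNth z) (z j) then 1 else 0) := by
        simp [hj]
    _ = ∑ z : Fin (s + 1) → β, (Finset.univ.filter fun j => bad (j.removeNth z) (z j)).card := by
        rw [Finset.sum_comm]
        exact Finset.sum_congr rfl fun z _ => (Finset.card_filter _ _).symm
    _ ≤ ∑ _z : Fin (s + 1) → β, B := Finset.sum_le_sum fun z _ => h z
    _ = B * Fintype.card β ^ (s + 1) := by simp [mul_comm]

/-- Every finite family of distributions has a coupling. -/
lemma exists_pmf_pi_fin {A : Type*} (n : ℕ) (P : Fin n → PMF A) :
    ∃ Q : PMF (Fin n → A), ∀ i, Q.map (fun f => f i) = P i := by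
  induction n with
  | zero => exact ⟨PMF.pure Fin.elim0, fun i => i.elim0⟩
  | succ n ih =>
    obtain ⟨Q, hQ⟩ := ih (Fin.tail P)
    refine ⟨(P 0).bind fun a => Q.map (Fin.cons a), fun i => ?_⟩
    rw [PMF.map_bind]
    simp only [PMF.map_comp]
    refine Fin.cases ?_ (fun i => ?_) i
    · have hc (a : A) : Q.map (fun _ => a) = PMF.pure a := Q.map_const a
      simp [Function.comp_def, hc]
    · have := hQ i
      simp only [Function.comp_def, Fin.cons_succ, this, PMF.bind_const]
      rfl

/-- An algorithm tosses all its coins before the first query, so its random continuations are drawn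
jointly for all possible answers. A fixed oracle sees only one marginal, so any coupling serves. -/
lemma exists_pmf_pi {ι A : Type*} [Finite ι] (P : ι → PMF A) :
    ∃ Q : PMF (ι → A), ∀ i, Q.map (fun f => f i) = P i := by
  obtain ⟨n, ⟨e⟩⟩ := Finite.exists_equiv_fin ι
  obtain ⟨Q, hQ⟩ := exists_pmf_pi_fin n (P ∘ e.symm)
  refine ⟨Q.map (fun f => f ∘ e), fun i => ?_⟩
  rw [PMF.map_comp]
  simpa [Function.comp_def] using hQ (e i)

/-! ### Batches of queries -/

section Batch

variable {α : Type} {k : ℕ}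

/-- Query a batch of points, then continue depending on all the answers. -/
def QueryTree.batch : (s : ℕ) → (Fin s → α) → ((Fin s → Fin k) → QueryTree α k) → QueryTree α k
  | 0, _, cont => cont Fin.elim0
  | s + 1, w, cont => .query (w 0) fun a =>
      QueryTree.batch s (Fin.tail w) fun l => cont (Fin.cons a l)

lemma comp_eq_cons (O : α → Fin k) {s : ℕ} (w : Fin (s + 1) → α) :
    (Fin.cons (O (w 0)) (O ∘ Fin.tail w) : Fin (s + 1) → Fin k) = O ∘ w := by
  funext i
  refine Fin.cases rfl (fun i => rfl) i

lemma QueryTree.result_batch (O : α → Fin k) (s : ℕ) (w : Fin s → α)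
    (cont : (Fin s → Fin k) → QueryTree α k) :
    (QueryTree.batch s w cont).result O = (cont (O ∘ w)).result O := by
  induction s with
  | zero => simp only [QueryTree.batch]; congr; exact Subsingleton.elim _ _
  | succ s ih => simp only [QueryTree.batch, QueryTree.result, ih, comp_eq_cons]

lemma QueryTree.numQueries_batch (O : α → Fin k) (s : ℕ) (w : Fin s → α)
    (cont : (Fin s → Fin k) → QueryTree α k) :
    (QueryTree.batch s w cont).numQueries O = (cont (O ∘ w)).numQueries O + s := by
  induction s with
  | zero => simp only [QueryTree.batch, add_zero]; congr; exact Subsingleton.elim _ _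
  | succ s ih => simp only [QueryTree.batch, QueryTree.numQueries, ih, comp_eq_cons]; ring

end Batch

/-! ### Labels forced by the margin -/

section Margin

variable {α : Type} [PseudoMetricSpace α] {k : ℕ}

/-- The margin condition in terms of points. -/
def PointwiseMargin (γ : ℝ) (O : α → Fin k) : Prop :=
  ∀ x y u v, O u = O x → O v = O x → O y ≠ O x → γ * dist u v < dist y x

/-- The labels `l` of the points `w` force the label `i` on `y` under margin `γ`. -/
def Forces (γ : ℝ) {s : ℕ} (w : Fin s → α) (l : Fin s → Fin k) (i : Fin k) (y : α) : Prop :=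
  ∃ a b c, l a = i ∧ l b = i ∧ l c = i ∧ dist y (w a) ≤ γ * dist (w b) (w c)

lemma Forces.eq {γ : ℝ} {O : α → Fin k} (hO : PointwiseMargin γ O) {s : ℕ} {w : Fin s → α}
    {i : Fin k} {y : α} (h : Forces γ w (O ∘ w) i y) : O y = i := by
  obtain ⟨a, b, c, ha, hb, hc, hle⟩ := h
  by_contra hy
  simp only [Function.comp_apply] at ha hb hc
  have := hO (w a) y (w b) (w c) (hb.trans ha.symm) (hc.trans ha.symm) (by rwa [ha])
  linarith

/-- The degenerate choice `b = c` has distance `0`. It makes every sampled point forced, so each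
round makes progress. -/
lemma forces_self (γ : ℝ) {s : ℕ} (w : Fin s → α) (l : Fin s → Fin k) (j : Fin s) :
    Forces γ w l (l j) (w j) :=
  ⟨j, j, j, rfl, rfl, rfl, by simp⟩

end Margin

/-! ### The randomized rounds and their query count -/

section Rounds

variable {m k : ℕ} {X : Finset (EuclideanSpace ℝ (Fin m))} {γ : ℝ}

lemma HasEuclideanMargin.pointwiseMargin {O : X → Fin k} (hγ : 0 < γ)
    (h : HasEuclideanMargin γ O) : PointwiseMargin γ O := by
  intro x y u v hu hv hy
  have hmem (z : X) (hz : O z = O x) : (z : EuclideanSpace ℝ (Fin m)) ∈ cluster O (O x) :=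
    ⟨z.2, hz⟩
  have h1 : ENNReal.ofReal (dist (u : EuclideanSpace ℝ (Fin m)) v) ≤
      diameter dist (cluster O (O x)) :=
    le_iSup₂_of_le u.1 (hmem u hu) (le_iSup₂_of_le v.1 (hmem v hv) le_rfl)
  have h2 : setDist dist ((X : Set (EuclideanSpace ℝ (Fin m))) \ cluster O (O x))
      (cluster O (O x)) ≤ ENNReal.ofReal (dist (y : EuclideanSpace ℝ (Fin m)) x) :=
    iInf₂_le_of_le y.1 ⟨y.2, fun ⟨_, hy'⟩ => hy hy'⟩ (iInf₂_le_of_le x.1 (hmem x rfl) le_rfl)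
  have h3 : ENNReal.ofReal γ * ENNReal.ofReal (dist (u : EuclideanSpace ℝ (Fin m)) v) <
      ENNReal.ofReal (dist (y : EuclideanSpace ℝ (Fin m)) x) :=
    (mul_le_mul_right h1 _).trans_lt ((h (O x)).trans_le h2)
  rw [← ENNReal.ofReal_mul hγ.le] at h3
  exact (ENNReal.ofReal_lt_ofReal_iff_of_nonneg (by positivity)).1 h3

/-- The number of points with labels in `Fin k` none of which is forced by the others is at most
this one. -/
noncomputable def extremeBound (m k : ℕ) (γ : ℝ) : ℕ :=
  k * (⌊(1 + 4 / γ) ^ m⌋₊ + 1)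

-- Within one label, unforced members satisfy the hypothesis of `card_le_of_forall_extreme`: a
-- violated inequality would force the member `j` from the others.
open Classical in
lemma card_not_forced_le (hγ : 0 < γ) (O : X → Fin k) {s : ℕ} (z : Fin (s + 1) → X) :
    (Finset.univ.filter fun j : Fin (s + 1) =>
      ∀ i, ¬ Forces γ (j.removeNth z) (O ∘ j.removeNth z) i (z j)).card ≤ extremeBound m k γ := by
  set F := Finset.univ.filter fun j : Fin (s + 1) =>
      ∀ i, ¬ Forces γ (j.removeNth z) (O ∘ j.removeNth z) i (z j) with hF
  rw [Finset.card_eq_sum_card_fiberwise (f := fun j => O (z j)) (t := Finset.univ)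
    (fun _ _ => Finset.mem_coe.2 (Finset.mem_univ _))]
  refine (Finset.sum_le_card_nsmul _ _ (⌊(1 + 4 / γ) ^ m⌋₊ + 1) fun i _ => ?_).trans_eq
    (by simp [extremeBound])
  have h := card_le_of_forall_extreme hγ (F.filter fun j => O (z j) = i)
    (fun j => (z j : EuclideanSpace ℝ (Fin m))) (by
      intro j hj a ha b hb c hc haj hbj hcj
      simp only [hF, Finset.mem_filter, Finset.mem_univ, true_and] at hj ha hb hc
      obtain ⟨a, rfl⟩ := Fin.exists_succAbove_eq haj
      obtain ⟨b, rfl⟩ := Fin.exists_succAbove_eq hbj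
      obtain ⟨c, rfl⟩ := Fin.exists_succAbove_eq hcj
      by_contra! hle
      exact hj.1 i ⟨a, b, c, ha.2, hb.2, hc.2, hle⟩)
  rw [← Nat.floor_add_one (by positivity)]
  exact Nat.le_floor h

open Classical in
/-- The points of `Y` that are not forced by the sample. -/
noncomputable def unforced (γ : ℝ) (Y : Finset X) {s : ℕ} (w : Fin s → X) (l : Fin s → Fin k) :
    Finset X :=
  Y.filter fun y => ∀ i, ¬ Forces γ w l i y

/-- The sample size `2 * B` is chosen so that the leave-one-out fraction `B / (2 * B + 1)` is below
one half. -/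
lemma two_mul_sum_card_unforced_le (hγ : 0 < γ) (hk : 0 < k) (O : X → Fin k) (Y : Finset X) :
    2 * ∑ w : Fin (2 * extremeBound m k γ) → Y,
      (unforced γ Y (fun j => (w j : X)) (fun j => O (w j))).card ≤
      Y.card * Y.card ^ (2 * extremeBound m k γ) := by
  classical
  have hB : 0 < extremeBound m k γ := by unfold extremeBound; positivity
  set B := extremeBound m k γ with hBdef
  have key := leave_one_out (β := Y) (2 * B) B
    (fun w y => ∀ i, ¬ Forces γ (fun j => (w j : X)) (fun j => O (w j)) i (y : X))
    (fun z => card_not_forced_le hγ O (fun j => (z j : X)))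
  have heq (w : Fin (2 * B) → Y) : (unforced γ Y (fun j => (w j : X)) (fun j => O (w j))).card =
      (Finset.univ.filter fun y : Y =>
        ∀ i, ¬ Forces γ (fun j => (w j : X)) (fun j => O (w j)) i (y : X)).card := by
    rw [unforced, ← Finset.card_map (Function.Embedding.subtype (· ∈ Y))]
    congr 1
    ext y
    simp [and_comm]
  simp only [heq]
  rw [Fintype.card_coe, pow_succ'] at key
  refine Nat.le_of_mul_le_mul_left ?_ hB
  refine le_trans ?_ key
  rw [← mul_assoc]
  exact Nat.mul_le_mul_right _ (by omega)

/-- The randomized strategy on the points `Y` whose labels are not known yet: label a random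
sample of `Y` and all points that are forced by it, and continue with the others. -/
theorem exists_strategy (hγ : 0 < γ) (hk : 0 < k) (N : ℕ) :
    ∀ Y : Finset X, Y.card = N → ∀ L : X → Fin k,
      ∃ P : PMF (QueryTree X k), ∀ O, PointwiseMargin γ O → (∀ x ∉ Y, O x = L x) →
        (∀ T ∈ P.support, T.result O = O) ∧
        ∀ t : ℕ, P.toOuterMeasure {T | 2 * extremeBound m k γ * t < T.numQueries O} ≤
          N / 2 ^ t := by
  classical
  induction N using Nat.strong_induction_on with
  | _ N ih =>
  intro Y hY L
  rcases Y.eq_empty_or_nonempty with rfl | hne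
  · refine ⟨PMF.pure (.output L), fun O _ hOL => ⟨fun T hT => ?_, fun t => ?_⟩⟩
    · rw [PMF.mem_support_pure_iff] at hT
      subst hT
      exact (funext fun x => hOL x (by simp)).symm
    · simp [PMF.toOuterMeasure_pure_apply, QueryTree.numQueries]
  have hB : 0 < extremeBound m k γ := by unfold extremeBound; positivity
  have hlt (w : Fin (2 * extremeBound m k γ) → Y) (l : Fin (2 * extremeBound m k γ) → Fin k) :
      (unforced γ Y (fun j => (w j : X)) l).card < N := by
    rw [← hY]
    refine Finset.card_lt_card (Finset.filter_ssubset.2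
      ⟨w ⟨0, by omega⟩, (w _).2, fun h => h _ (forces_self γ _ l ⟨0, by omega⟩)⟩)
  -- If several labels are forced, the answers come from no oracle with the margin, and the choice
  -- is irrelevant.
  let L' (w : Fin (2 * extremeBound m k γ) → Y) (l : Fin (2 * extremeBound m k γ) → Fin k) :
      X → Fin k := fun y =>
    if h : y ∈ Y ∧ ∃ i, Forces γ (fun j => (w j : X)) l i y then h.2.choose else L y
  choose P' hP' using fun w l => ih _ (hlt w l) _ rfl (L' w l)
  choose Q hQ using fun w => exists_pmf_pi (P' w)
  have : Nonempty Y := hne.to_subtype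
  refine ⟨(PMF.uniformOfFintype (Fin (2 * extremeBound m k γ) → Y)).bind fun w =>
    (Q w).map (QueryTree.batch _ fun j => (w j : X)), fun O hO hOL => ?_⟩
  have hL' (w : Fin (2 * extremeBound m k γ) → Y) :
      ∀ x ∉ unforced γ Y (fun j => (w j : X)) (fun j => O (w j)),
        O x = L' w (fun j => O (w j)) x := by
    intro x hx
    by_cases h : x ∈ Y ∧ ∃ i, Forces γ (fun j => (w j : X)) (fun j => O (w j)) i x
    · simp only [L', dif_pos h]
      exact h.2.choose_spec.eq hO
    · simp only [L', dif_neg h]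
      refine hOL x fun hxY => hx ?_
      simp only [unforced, Finset.mem_filter]
      exact ⟨hxY, fun i hi => h ⟨hxY, i, hi⟩⟩
  refine ⟨fun T hT => ?_, fun t => ?_⟩
  · obtain ⟨w, -, hT⟩ := (PMF.mem_support_bind_iff _ _ _).1 hT
    obtain ⟨g, hg, rfl⟩ := (PMF.mem_support_map_iff _ _ _).1 hT
    rw [QueryTree.result_batch]
    refine (hP' w _ O hO (hL' w)).1 _ ?_
    rw [← hQ]
    exact (PMF.mem_support_map_iff _ _ _).2 ⟨g, hg, rfl⟩
  · cases t with
    | zero =>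
      have h1 (P : PMF (QueryTree X k)) (S : Set (QueryTree X k)) : P.toOuterMeasure S ≤ 1 := by
        rw [← (P.toOuterMeasure_apply_eq_one_iff Set.univ).2 (Set.subset_univ _)]
        exact P.toOuterMeasure.mono (Set.subset_univ _)
      refine (h1 _ _).trans ?_
      have : 1 ≤ N := by rw [← hY]; exact hne.card_pos
      simpa using this
    | succ t =>
      have hw (w : Fin (2 * extremeBound m k γ) → Y) :
          ((Q w).map (QueryTree.batch _ fun j => (w j : X))).toOuterMeasure
            {T | 2 * extremeBound m k γ * (t + 1) < T.numQueries O} ≤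
          (unforced γ Y (fun j => (w j : X)) (fun j => O (w j))).card / 2 ^ t := by
        -- Given the sample `w`, only the marginal of `Q w` at the true answers matters, and the
        -- batch uses up the budget of one round.
        refine le_trans (le_of_eq ?_) ((hP' w _ O hO (hL' w)).2 t)
        rw [← hQ, PMF.toOuterMeasure_map_apply, PMF.toOuterMeasure_map_apply]
        congr 1
        ext g
        simp only [Set.mem_preimage, Set.mem_ofPred_eq, QueryTree.numQueries_batch, mul_add, mul_one,
          add_lt_add_iff_right, Function.comp_def]
      rw [PMF.toOuterMeasure_bind_apply, tsum_fintype]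
      calc _ ≤ ∑ w : Fin (2 * extremeBound m k γ) → Y,
            ((N : ℝ≥0∞) ^ (2 * extremeBound m k γ))⁻¹ *
              ((unforced γ Y (fun j => (w j : X)) (fun j => O (w j))).card / 2 ^ t) := by
            refine Finset.sum_le_sum fun w _ => ?_
            rw [PMF.uniformOfFintype_apply]
            refine mul_le_mul' (le_of_eq ?_) (hw w)
            simp [hY]
        _ = ((N : ℝ≥0∞) ^ (2 * extremeBound m k γ))⁻¹ *
            ((2 * ∑ w : Fin (2 * extremeBound m k γ) → Y,
              ((unforced γ Y (fun j => (w j : X)) (fun j => O (w j))).card : ℝ≥0∞)) /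
                2 ^ (t + 1)) := by
            rw [← Finset.mul_sum, pow_succ', ENNReal.mul_div_mul_left _ _ (by simp) (by simp)]
            simp only [div_eq_mul_inv, Finset.sum_mul]
        _ ≤ ((N : ℝ≥0∞) ^ (2 * extremeBound m k γ))⁻¹ *
            (((N : ℝ≥0∞) ^ (2 * extremeBound m k γ) * N) / 2 ^ (t + 1)) := by
            refine mul_le_mul_right (ENNReal.div_le_div_right ?_ _) _
            have := two_mul_sum_card_unforced_le hγ hk O Y
            rw [hY, mul_comm N] at this
            exact_mod_cast this
        _ = N / 2 ^ (t + 1) := by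
            have hN : (N : ℝ≥0∞) ≠ 0 := by
              rw [← hY]
              exact_mod_cast hne.card_pos.ne'
            rw [mul_div_assoc, ← mul_assoc, ENNReal.inv_mul_cancel, one_mul]
            · exact pow_ne_zero _ hN
            · exact ENNReal.pow_ne_top (ENNReal.natCast_ne_top N)

/-- The constant `K_a` of the upper bound. -/
noncomputable def queryConst (a : ℝ) : ℝ :=
  3 * (2 + a) / Real.log 2 ^ 2

lemma extremeBound_mul_le (hγ : 0 < γ) (hk : 2 ≤ k) {n t : ℕ} (hn : 2 ≤ n) {a : ℝ} (ha : 0 < a)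
    (ht : (t : ℝ) ≤ (1 + a) * Real.log n / Real.log 2 + 1) :
    ((2 * extremeBound m k γ * t : ℕ) : ℝ) ≤
      queryConst a * (packingBound m γ * k * Real.log k * Real.log n) := by
  have hl2 : 0 < Real.log 2 := Real.log_pos one_lt_two
  have hln : Real.log 2 ≤ Real.log n := Real.log_le_log two_pos (by exact_mod_cast hn)
  have hlk : Real.log 2 ≤ Real.log k := Real.log_le_log two_pos (by exact_mod_cast hk)
  have hM2 : 2 ≤ packingBound m γ := le_max_left _ _
  have hs : ((2 * extremeBound m k γ : ℕ) : ℝ) ≤ 3 * packingBound m γ * k := by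
    have h1 : ((⌊(1 + 4 / γ) ^ m⌋₊ : ℕ) : ℝ) ≤ packingBound m γ :=
      (Nat.floor_le (by positivity)).trans (le_max_right _ _)
    have hk0 : (0 : ℝ) ≤ k := k.cast_nonneg
    -- The constant `3` works because `2 * (M + 1) ≤ 3 * M` for `M ≥ 2`.
    simp only [extremeBound]
    push_cast
    nlinarith
  have ht' : (t : ℝ) ≤ (2 + a) * Real.log n / Real.log 2 := by
    refine ht.trans ?_
    rw [div_add_one hl2.ne']
    gcongr
    linarith
  rw [Nat.cast_mul]
  calc ((2 * extremeBound m k γ : ℕ) : ℝ) * t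
      ≤ (3 * packingBound m γ * k) * ((2 + a) * Real.log n / Real.log 2) := by
        gcongr
    _ = (3 * packingBound m γ * k) * ((2 + a) * Real.log n / Real.log 2) * 1 := by ring
    _ ≤ (3 * packingBound m γ * k) * ((2 + a) * Real.log n / Real.log 2) *
          (Real.log k / Real.log 2) := by
        have : 0 ≤ Real.log n := hl2.le.trans hln
        gcongr
        rwa [one_le_div hl2]
    _ = _ := by
        rw [queryConst]
        field_simp

lemma nat_div_two_pow_le {n t : ℕ} (hn : 2 ≤ n) {a : ℝ}
    (ht : (1 + a) * Real.log n / Real.log 2 ≤ t) :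
    (n : ℝ≥0∞) / 2 ^ t ≤ ENNReal.ofReal ((n : ℝ) ^ (-a)) := by
  have hl2 : 0 < Real.log 2 := Real.log_pos one_lt_two
  have hn0 : (0 : ℝ) < n := by positivity
  have h : (n : ℝ) / 2 ^ t ≤ (n : ℝ) ^ (-a) := by
    rw [div_le_iff₀ (by positivity)]
    rw [div_le_iff₀ hl2] at ht
    rw [← Real.log_le_log_iff hn0 (by positivity), Real.log_mul (by positivity) (by positivity),
      Real.log_rpow hn0, Real.log_pow]
    linarith
  refine le_trans (le_of_eq ?_) (ENNReal.ofReal_le_ofReal h)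
  rw [ENNReal.ofReal_div_of_pos (by positivity), ENNReal.ofReal_natCast,
    ENNReal.ofReal_pow (by positivity)]
  simp

end Rounds

theorem exists_algorithm (m k : ℕ) {γ : ℝ} (hγ : 0 < γ) :
    ∃ A : Algorithm (EuclideanSpace ℝ (Fin m)) k,
      ∀ (X : Finset (EuclideanSpace ℝ (Fin m))) (O : X → Fin k), HasEuclideanMargin γ O →
        A.AlwaysRecovers X O ∧ ∀ a : ℝ, 0 < a →
          ENNReal.ofReal (1 - (X.card : ℝ) ^ (-a)) ≤ A.probQueriesLE X O
            (queryConst a * (packingBound m γ * k * Real.log k * Real.log X.card)) := by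
  suffices h : ∀ X : Finset (EuclideanSpace ℝ (Fin m)), ∃ P : PMF (QueryTree X k),
      ∀ O : X → Fin k, HasEuclideanMargin γ O → (∀ T ∈ P.support, T.result O = O) ∧
        ∀ a : ℝ, 0 < a → ENNReal.ofReal (1 - (X.card : ℝ) ^ (-a)) ≤ P.toOuterMeasure
          {T | (T.numQueries O : ℝ) ≤
            queryConst a * (packingBound m γ * k * Real.log k * Real.log X.card)} by
    choose A hA using h
    exact ⟨A, hA⟩
  intro X
  by_cases hL : Nonempty (X → Fin k)
  swap
  · have hX : Nonempty X := by
      by_contra hX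
      rw [not_nonempty_iff] at hX
      exact hL ⟨isEmptyElim⟩
    have hk : IsEmpty (Fin k) := by
      by_contra hk
      rw [not_isEmpty_iff] at hk
      exact hL inferInstance
    exact ⟨PMF.pure (.query hX.some isEmptyElim), fun O => (hL ⟨O⟩).elim⟩
  obtain ⟨L⟩ := hL
  -- Here the query bound may be `0` (`k = 1` or `X` empty), so nothing may be queried.
  by_cases htriv : Subsingleton (X → Fin k)
  · refine ⟨PMF.pure (.output L), fun O _ => ⟨fun T _ => Subsingleton.elim _ _, fun a ha => ?_⟩⟩
    have h0 : 0 ≤ queryConst a * (packingBound m γ * k * Real.log k * Real.log X.card) := by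
      have : 0 ≤ packingBound m γ := zero_le_two.trans (le_max_left _ _)
      have := Real.log_natCast_nonneg k
      have := Real.log_natCast_nonneg X.card
      rw [queryConst]
      positivity
    rw [PMF.toOuterMeasure_pure_apply, if_pos (by simpa [QueryTree.numQueries] using h0)]
    rw [← ENNReal.ofReal_one]
    exact ENNReal.ofReal_le_ofReal (by linarith [Real.rpow_nonneg X.card.cast_nonneg (-a)])
  have hk : 2 ≤ k := by
    by_contra! hk
    have : Subsingleton (Fin k) := Fin.subsingleton_iff_le_one.2 (by omega)
    exact htriv inferInstance
  obtain ⟨P, hP⟩ := exists_strategy hγ (two_pos.trans_le hk) _ (Finset.univ : Finset X) rfl L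
  refine ⟨P, fun O hO => ?_⟩
  obtain ⟨hrec, htail⟩ := hP O (hO.pointwiseMargin hγ) (by simp)
  refine ⟨hrec, fun a ha => ?_⟩
  -- For a single point the query bound is `0`, but so is the required probability `1 - 1 ^ (-a)`.
  rcases lt_or_ge X.card 2 with hn | hn
  · have hn1 : X.card = 1 := by
      have : X.card ≠ 0 := by
        intro h0
        rw [Finset.card_eq_zero] at h0
        subst h0
        exact htriv inferInstance
      omega
    simp [hn1]
  -- The least number of rounds with `n / 2 ^ t ≤ n ^ (-a)`.
  set t := ⌈(1 + a) * Real.log X.card / Real.log 2⌉₊ with ht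
  have hpos : 0 ≤ (1 + a) * Real.log X.card / Real.log 2 := by
    have := Real.log_natCast_nonneg X.card
    have := Real.log_nonneg one_le_two
    positivity
  have hcompl := htail t
  rw [Finset.card_univ, Fintype.card_coe] at hcompl
  have hone : 1 ≤ P.toOuterMeasure {T | T.numQueries O ≤ 2 * extremeBound m k γ * t} +
      P.toOuterMeasure {T | 2 * extremeBound m k γ * t < T.numQueries O} := by
    rw [← (P.toOuterMeasure_apply_eq_one_iff Set.univ).2 (Set.subset_univ _)]
    refine (P.toOuterMeasure.mono fun T _ => ?_).trans (MeasureTheory.measure_union_le _ _)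
    exact le_or_gt (T.numQueries O) _
  have hge : ENNReal.ofReal (1 - (X.card : ℝ) ^ (-a)) ≤
      P.toOuterMeasure {T | T.numQueries O ≤ 2 * extremeBound m k γ * t} := by
    rw [ENNReal.ofReal_sub _ (Real.rpow_nonneg X.card.cast_nonneg _), ENNReal.ofReal_one]
    refine tsub_le_iff_right.2 (hone.trans ?_)
    gcongr
    exact hcompl.trans (nat_div_two_pow_le hn (Nat.le_ceil _))
  refine hge.trans (P.toOuterMeasure.mono fun T hT => ?_)
  exact (Nat.cast_le.2 hT).trans
    (extremeBound_mul_le hγ hk hn ha (Nat.ceil_lt_add_one hpos).le)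

/-! ### Searching for a needle -/

section Needle

variable {α : Type} [DecidableEq α] {k : ℕ}

/-- The labelling that singles out the point `j` by the label `b`. -/
def needle (a b : Fin k) (j : α) : α → Fin k := fun x => if x = j then b else a

lemma needle_injective {a b : Fin k} (hab : a ≠ b) :
    Function.Injective (needle a b : α → α → Fin k) := by
  intro i j h
  have := congrFun h i
  by_contra hij
  simp [needle, hij, hab.symm] at this

/-- As long as the answer is `a`, the run is the same for all needles. A query at `x` tells apart
only the needle at `x`, hence gains at most one success, while every needle in `J` pays for it. The
induction removes `x` from `J`, so `J` must be arbitrary. -/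
lemma card_mul_card_success_le [Fintype α] {a b : Fin k} (hab : a ≠ b) (T : QueryTree α k) :
    ∀ J : Finset α,
      J.card * (J.filter fun j => T.result (needle a b j) = needle a b j).card ≤
        2 * ∑ j ∈ J, T.numQueries (needle a b j) + J.card := by
  induction T with
  | output C =>
    intro J
    have h1 : (J.filter fun j => C = needle a b j).card ≤ 1 := by
      refine Finset.card_le_one.2 fun i hi j hj => needle_injective hab ?_
      rw [← (Finset.mem_filter.1 hi).2, (Finset.mem_filter.1 hj).2]
    change J.card * (J.filter fun j => C = needle a b j).card ≤ _
    exact (Nat.mul_le_mul_left _ h1).trans (by omega)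
  | query x next ih =>
    intro J
    have hne {j : α} (hj : j ≠ x) : needle a b j x = a := by simp [needle, hj.symm]
    have hE := ih a (J.erase x)
    have hsum : ∑ j ∈ J.erase x, (next (needle a b j x)).numQueries (needle a b j) =
        ∑ j ∈ J.erase x, (next a).numQueries (needle a b j) :=
      Finset.sum_congr rfl fun j hj => by rw [hne (Finset.ne_of_mem_erase hj)]
    have hfil : (J.erase x).filter (fun j =>
          (next (needle a b j x)).result (needle a b j) = needle a b j) =
        (J.erase x).filter fun j => (next a).result (needle a b j) = needle a b j :=
      Finset.filter_congr fun j hj => by rw [hne (Finset.ne_of_mem_erase hj)]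
    rw [← hsum, ← hfil] at hE
    change J.card * (J.filter fun j =>
      (next (needle a b j x)).result (needle a b j) = needle a b j).card ≤ _
    simp only [QueryTree.numQueries, Finset.sum_add_distrib, Finset.sum_const,
      smul_eq_mul, mul_one]
    by_cases hx : x ∈ J
    · have hc := Finset.card_erase_add_one hx
      have hs := Finset.sum_erase_add J
        (fun j => (next (needle a b j x)).numQueries (needle a b j)) hx
      have hle : (J.filter fun j =>
          (next (needle a b j x)).result (needle a b j) = needle a b j).card ≤
          ((J.erase x).filter fun j =>
            (next (needle a b j x)).result (needle a b j) = needle a b j).card + 1 := by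
        rw [Finset.filter_erase]
        have := Finset.pred_card_le_card_erase (a := x) (s := J.filter fun j =>
          (next (needle a b j x)).result (needle a b j) = needle a b j)
        omega
      have hle2 := Finset.card_filter_le (J.erase x) fun j =>
            (next (needle a b j x)).result (needle a b j) = needle a b j
      rw [← hc, ← hs]
      have := Nat.mul_le_mul_left ((J.erase x).card + 1) hle
      nlinarith
    · rw [Finset.erase_eq_of_notMem hx] at hE
      omega

lemma card_mul_sum_success_le [Fintype α] {a b : Fin k} (hab : a ≠ b)
    (P : PMF (QueryTree α k)) :
    (Fintype.card α : ℝ≥0∞) *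
        ∑ j, P.toOuterMeasure {T | T.result (needle a b j) = needle a b j} ≤
      2 * ∑ j, ∑' T, P T * (T.numQueries (needle a b j) : ℝ≥0∞) + Fintype.card α := by
  have hsucc : ∑ j, P.toOuterMeasure {T | T.result (needle a b j) = needle a b j} =
      ∑' T, P T * ((Finset.univ.filter fun j =>
        T.result (needle a b j) = needle a b j).card : ℝ≥0∞) := by
    simp only [PMF.toOuterMeasure_apply]
    rw [← Summable.tsum_finsetSum fun _ _ => ENNReal.summable]
    refine tsum_congr fun T => ?_
    rw [Finset.card_filter, Nat.cast_sum, Finset.mul_sum]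
    refine Finset.sum_congr rfl fun j _ => ?_
    by_cases h : T.result (needle a b j) = needle a b j <;> simp [Set.indicator, h]
  have hquer : ∑ j, ∑' T, P T * (T.numQueries (needle a b j) : ℝ≥0∞) =
      ∑' T, P T * ((∑ j, T.numQueries (needle a b j) : ℕ) : ℝ≥0∞) := by
    rw [← Summable.tsum_finsetSum fun _ _ => ENNReal.summable]
    refine tsum_congr fun T => ?_
    rw [Nat.cast_sum, Finset.mul_sum]
  have hone : (Fintype.card α : ℝ≥0∞) = ∑' T, P T * (Fintype.card α : ℝ≥0∞) := by
    rw [ENNReal.tsum_mul_right, P.tsum_coe, one_mul]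
  rw [hsucc, hquer]
  conv_rhs => rw [hone]
  rw [← ENNReal.tsum_mul_left, ← ENNReal.tsum_mul_left, ← ENNReal.tsum_add]
  refine ENNReal.tsum_le_tsum fun T => ?_
  have := card_mul_card_success_le hab T Finset.univ
  rw [Finset.card_univ] at this
  calc _ = P T * ((Fintype.card α * (Finset.univ.filter fun j =>
        T.result (needle a b j) = needle a b j).card : ℕ) : ℝ≥0∞) := by
        push_cast
        ring
    _ ≤ P T * ((2 * ∑ j, T.numQueries (needle a b j) + Fintype.card α : ℕ) : ℝ≥0∞) := by
        gcongr
    _ = _ := by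
        push_cast
        ring

/-- Averaging over a uniform needle: if all expectations were below `p * n / 4`, then `n ^ 2 * p ≤ n
^ 2 * p / 2 + n`, contradicting `2 < p * n`. -/
lemma exists_le_expectedQueries {𝒳 : Type} [DecidableEq 𝒳] {a b : Fin k} (hab : a ≠ b)
    (A : Algorithm 𝒳 k) (X : Finset 𝒳) {p : ℝ} (hp : 0 < p) (hX : 2 < p * X.card)
    (h : ∀ j : X, ENNReal.ofReal p ≤ A.successProb X (needle a b j)) :
    ∃ j : X, ENNReal.ofReal (1 / 4 * p * X.card) ≤ A.expectedQueries X (needle a b j) := by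
  by_contra! hlt
  have key := card_mul_sum_success_le hab (A X)
  rw [Fintype.card_coe] at key
  have h1 : (X.card : ℝ≥0∞) * ENNReal.ofReal p ≤
      ∑ j : X, (A X).toOuterMeasure {T | T.result (needle a b j) = needle a b j} := by
    have := Finset.card_nsmul_le_sum (Finset.univ : Finset X) _ _ fun j _ => h j
    rwa [nsmul_eq_mul, Finset.card_univ, Fintype.card_coe] at this
  have h2 : ∑ j : X, ∑' T, (A X) T * (T.numQueries (needle a b j) : ℝ≥0∞) ≤
      X.card * ENNReal.ofReal (1 / 4 * p * X.card) := by
    have := Finset.sum_le_card_nsmul (Finset.univ : Finset X) _ _ fun j _ => (hlt j).le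
    rwa [nsmul_eq_mul, Finset.card_univ, Fintype.card_coe] at this
  have h3 : (X.card : ℝ≥0∞) * (X.card * ENNReal.ofReal p) ≤
      2 * (X.card * ENNReal.ofReal (1 / 4 * p * X.card)) + X.card :=
    (mul_le_mul_right h1 _).trans (key.trans (by gcongr))
  have h4 : ENNReal.ofReal (X.card * (X.card * p)) ≤
      ENNReal.ofReal (2 * (X.card * (1 / 4 * p * X.card)) + X.card) := by
    rw [ENNReal.ofReal_add (by positivity) (by positivity), ENNReal.ofReal_mul (by positivity),
      ENNReal.ofReal_mul (by positivity), ENNReal.ofReal_mul (by positivity),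
      ENNReal.ofReal_mul (q := 1 / 4 * p * X.card) (by positivity), ENNReal.ofReal_natCast,
      ENNReal.ofReal_ofNat]
    exact h3
  rw [ENNReal.ofReal_le_ofReal_iff (by positivity)] at h4
  have hn : (0 : ℝ) < X.card := by
    by_contra! h0
    nlinarith
  nlinarith [mul_pos hn (sub_pos.2 hX)]

end Needle

/-! ### Similar copies of concepts and point sets on spheres -/

section Geometry

variable {E : Type*} [NormedAddCommGroup E] [InnerProductSpace ℝ E]

/-- A set that contains a ball and is not everything has a similar copy that contains most of
a given ball but misses a given point of its boundary. -/
lemma exists_affineEquiv_closedBall_subset_image {h : Set E} {c : E} {r : ℝ} (hr : 0 < r)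
    (hball : Metric.ball c r ⊆ h) (hne : hᶜ.Nonempty) {x y : E} {ρ : ℝ} (hρ : 0 < ρ)
    (hxy : ρ < dist y x) :
    ∃ f : E ≃ᵃ[ℝ] E, x ∉ f '' h ∧ Metric.closedBall y ρ ⊆ f '' h := by
  have hinf : r ≤ Metric.infDist c hᶜ := by
    refine (Metric.le_infDist hne).2 fun z hz => ?_
    by_contra! hlt
    exact hz (hball (by rwa [Metric.mem_ball']))
  have hinf0 := hr.trans_le hinf
  -- The complement need not be closed, so `p` is only an almost nearest point; the slack is the
  -- ratio `dist y x / ρ > 1`.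
  obtain ⟨p, hp, hpc⟩ := (Metric.infDist_lt_iff hne (r := Metric.infDist c hᶜ * (dist y x / ρ))).1
    (lt_mul_of_one_lt_right hinf0 ((one_lt_div hρ).2 hxy))
  have hcp : 0 < dist c p := hinf0.trans_le (Metric.infDist_le_dist_of_mem hp)
  have hyx : 0 < dist y x := hρ.trans hxy
  set σ : ℝ := dist y x / dist c p with hσ
  have hσ0 : 0 < σ := div_pos hyx hcp
  set v := σ • (c - p) with hv
  have hnorm : ‖v‖ = ‖y - x‖ := by
    rw [hv, norm_smul, ← dist_eq_norm, ← dist_eq_norm, Real.norm_of_nonneg hσ0.le, hσ,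
      div_mul_cancel₀ _ hcp.ne']
  -- A reflection exchanges two vectors of equal norm. With it, the similarity `f` of ratio `σ`
  -- sends `c` to `y` and `p` to `x`.
  set R : E ≃ₗᵢ[ℝ] E := (ℝ ∙ (v - (y - x)))ᗮ.reflection with hR
  have hRv : R v = y - x := Submodule.reflection_sub hnorm
  let f : E ≃ᵃ[ℝ] E := ((AffineEquiv.vaddConst ℝ p).symm.trans
    ((LinearEquiv.smulOfNeZero ℝ E σ hσ0.ne').trans R.toLinearEquiv).toAffineEquiv).trans
      (AffineEquiv.vaddConst ℝ x)
  have hf (z : E) : f z = R (σ • (z - p)) + x := rfl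
  refine ⟨f, ?_, fun z hz => ?_⟩
  · rintro ⟨q, hq, hqx⟩
    have : f q = f p := by rw [hqx, hf, sub_self, smul_zero, map_zero, zero_add]
    exact hp (f.injective this ▸ hq)
  · obtain ⟨q, rfl⟩ := f.surjective z
    refine ⟨q, ?_, rfl⟩
    have hfc : f c = y := by rw [hf, hRv, sub_add_cancel]
    have hdist : dist (f q) y = σ * dist c q := by
      rw [← hfc, hf, hf, dist_add_right, R.dist_map, dist_smul₀, Real.norm_of_nonneg hσ0.le,
        dist_sub_right, dist_comm]
    rw [Metric.mem_closedBall, hdist] at hz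
    have hlt : dist c q < Metric.infDist c hᶜ := by
      refine lt_of_mul_lt_mul_left (hz.trans_lt ?_) hσ0.le
      rw [hσ, div_mul_eq_mul_div, lt_div_iff₀ hcp]
      have := mul_lt_mul_of_pos_left hpc hρ
      calc ρ * dist c p < ρ * (Metric.infDist c hᶜ * (dist y x / ρ)) := this
        _ = _ := by field_simp
    simpa using Metric.notMem_of_dist_lt_infDist hlt

/-- Strict convexity: on the unit sphere only `x` has distance `2` from `-x`. -/
lemma norm_add_lt_two_of_ne {x y : E} (hx : ‖x‖ = 1) (hy : ‖y‖ = 1) (hxy : y ≠ x) :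
    ‖y + x‖ < 2 := by
  have h1 := parallelogram_law_with_norm ℝ y x
  have h2 : 0 < ‖y - x‖ := norm_pos_iff.2 (sub_ne_zero.2 hxy)
  rw [hx, hy] at h1
  nlinarith [norm_nonneg (y + x)]

/-- On finite subsets of the unit sphere every point can be cut off by a similar copy. -/
lemma exists_affineEquiv_singling_out {h : Set E} {c : E} {r : ℝ} (hr : 0 < r)
    (hball : Metric.ball c r ⊆ h) (hne : hᶜ.Nonempty) (X : Finset E) (hX : ∀ x ∈ X, ‖x‖ = 1)
    {x : E} (hx : x ∈ X) :
    ∃ f : E ≃ᵃ[ℝ] E, x ∉ f '' h ∧ ∀ y ∈ X, y ≠ x → y ∈ f '' h := by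
  classical
  obtain ⟨ρ, hρ, hρ2, hle⟩ : ∃ ρ : ℝ, 0 < ρ ∧ ρ < 2 ∧ ∀ y ∈ X, y ≠ x → dist y (-x) ≤ ρ := by
    rcases (X.erase x).eq_empty_or_nonempty with he | he
    · refine ⟨1, one_pos, one_lt_two, fun y hy hyx => ?_⟩
      simpa [he] using Finset.mem_erase.2 ⟨hyx, hy⟩
    · obtain ⟨z, hz, hmax⟩ := (X.erase x).exists_max_image (fun y => dist y (-x)) he
      obtain ⟨hzx, hz⟩ := Finset.mem_erase.1 hz
      refine ⟨max 1 (dist z (-x)), by positivity, max_lt one_lt_two ?_, fun y hy hyx =>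
        (hmax y (Finset.mem_erase.2 ⟨hyx, hy⟩)).trans (le_max_right _ _)⟩
      rw [dist_eq_norm, sub_neg_eq_add]
      exact norm_add_lt_two_of_ne (hX x hx) (hX z hz) hzx
  have hdist : dist (-x) x = 2 := by
    rw [dist_eq_norm, ← norm_neg, neg_sub, sub_neg_eq_add, ← two_smul ℝ, norm_smul, hX x hx]
    norm_num
  obtain ⟨f, hf, hsub⟩ := exists_affineEquiv_closedBall_subset_image hr hball hne hρ
    (hdist.symm ▸ hρ2)
  exact ⟨f, hf, fun y hy hyx => hsub (hle y hy hyx)⟩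

/-- On spheres there are large finite sets in which every point is close to another one while the
other ones have diameter `2`. -/
lemma exists_finset_sphere (hE : 1 < Module.rank ℝ E) (N : ℕ) {ε : ℝ} (hε : 0 < ε) :
    ∃ X : Finset E, N ≤ X.card ∧ (∀ x ∈ X, ‖x‖ = 1) ∧ ∀ x ∈ X,
      (∃ y ∈ X, y ≠ x ∧ dist x y ≤ ε) ∧ ∃ u ∈ X, ∃ v ∈ X, u ≠ x ∧ v ≠ x ∧ dist u v = 2 := by
  classical
  have : Nontrivial E := by
    by_contra hn
    rw [not_nontrivial_iff_subsingleton] at hn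
    simp [rank_subsingleton'] at hE
  obtain ⟨e, he⟩ := exists_norm_eq E zero_le_one
  have hpos (x : E) (hx : ‖x‖ = 1) : dist x (-x) = 2 := by
    rw [dist_eq_norm, sub_neg_eq_add, ← two_smul ℝ, norm_smul, hx]
    norm_num
  -- The sphere is connected in dimension at least two, hence has no isolated points.
  have hsph : AccPt e (Filter.principal (Metric.sphere (0 : E) 1)) := by
    refine (isPreconnected_sphere hE 0 1).preperfect_of_nontrivial
      ⟨e, by simp [he], -e, by simp [he], fun h => ?_⟩ e (by simp [he])
    have := hpos e he
    rw [← h, dist_self] at this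
    norm_num at this
  -- The bound `ε / 2` makes points of `A` `ε`-close; `1 / 2` keeps them from being antipodal.
  set δ := min (ε / 2) (1 / 2) with hδ
  have hδ0 : 0 < δ := by positivity
  have hδε : 2 * δ ≤ ε := by linarith [min_le_left (ε / 2) (1 / 2)]
  have hδ1 : 2 * δ ≤ 1 := by linarith [min_le_right (ε / 2) (1 / 2)]
  have hinf : (Metric.ball e δ ∩ Metric.sphere (0 : E) 1).Infinite :=
    Set.Infinite.of_accPt (hsph.nhds_inter (Metric.ball_mem_nhds e hδ0))
  obtain ⟨A, hA, hcard⟩ := hinf.exists_subset_card_eq (N + 2)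
  have hA1 (x) (hx : x ∈ A) : ‖x‖ = 1 := by simpa using (hA hx).2
  have hAd (x) (hx : x ∈ A) (y) (hy : y ∈ A) : dist x y < 2 * δ := by
    have h1 : dist x e < δ := (hA hx).1
    have h2 : dist y e < δ := (hA hy).1
    linarith [dist_triangle_right x y e]
  have hAn (x) (hx : x ∈ A) (y) (hy : y ∈ A) : -y ≠ x := by
    rintro rfl
    have h1 := hAd _ hx _ hy
    rw [dist_comm, hpos y (hA1 y hy)] at h1
    linarith
  have hAne (x) : ∃ y ∈ A, y ≠ x := Finset.exists_mem_ne (by omega) x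
  refine ⟨A ∪ A.image Neg.neg, ?_, ?_, ?_⟩
  · exact le_trans (by omega) (Finset.card_le_card Finset.subset_union_left)
  · intro x hx
    rcases Finset.mem_union.1 hx with hx | hx
    · exact hA1 x hx
    · obtain ⟨y, hy, rfl⟩ := Finset.mem_image.1 hx
      rw [norm_neg, hA1 y hy]
  · intro x hx
    have hl {z} (hz : z ∈ A) : z ∈ A ∪ A.image Neg.neg := Finset.mem_union_left _ hz
    have hr {z} (hz : z ∈ A) : -z ∈ A ∪ A.image Neg.neg :=
      Finset.mem_union_right _ (Finset.mem_image_of_mem _ hz)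
    rcases Finset.mem_union.1 hx with hx | hx
    · obtain ⟨y, hy, hyx⟩ := hAne x
      exact ⟨⟨y, hl hy, hyx, by linarith [hAd x hx y hy]⟩,
        y, hl hy, -y, hr hy, hyx, hAn x hx y hy, hpos y (hA1 y hy)⟩
    · obtain ⟨z, hz, rfl⟩ := Finset.mem_image.1 hx
      obtain ⟨y, hy, hyz⟩ := hAne z
      refine ⟨⟨-y, hr hy, fun h => hyz (neg_injective h), ?_⟩, y, hl hy, -y, hr hy,
        (hAn y hy z hz).symm, fun h => hyz (neg_injective h), hpos y (hA1 y hy)⟩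
      rw [dist_neg_neg]
      linarith [hAd z hz y hy]

end Geometry

/-! ### Needle instances are realized and have small margin -/

section LowerBound

variable {m k : ℕ} {X : Finset (EuclideanSpace ℝ (Fin m))}

lemma exists_hasEuclideanMargin (O : X → Fin k) : ∃ γ > 0, HasEuclideanMargin γ O := by
  classical
  obtain ⟨μ, hμ, hsep⟩ : ∃ μ : ℝ, 0 < μ ∧ ∀ x ∈ X, ∀ y ∈ X, x ≠ y → μ ≤ dist x y := by
    set F := (X ×ˢ X).filter fun q => q.1 ≠ q.2 with hF
    have hmem {x y} (hx : x ∈ X) (hy : y ∈ X) (hxy : x ≠ y) : (x, y) ∈ F :=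
      Finset.mem_filter.2 ⟨Finset.mk_mem_product hx hy, hxy⟩
    rcases F.eq_empty_or_nonempty with he | he
    · refine ⟨1, one_pos, fun x hx y hy hxy => ?_⟩
      simpa [he] using hmem hx hy hxy
    · obtain ⟨q, hq, hmin⟩ := F.exists_min_image (fun q => dist q.1 q.2) he
      exact ⟨dist q.1 q.2, dist_pos.2 (Finset.mem_filter.1 hq).2, fun x hx y hy hxy =>
        hmin (x, y) (hmem hx hy hxy)⟩
  set D := Metric.diam (X : Set (EuclideanSpace ℝ (Fin m))) + 1 with hD
  have hD0 : 0 < D := by positivity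
  -- Halving `μ` gives the strict inequality; the `+ 1` in `D` covers diameter `0`.
  refine ⟨μ / 2 / D, by positivity, fun i => ?_⟩
  have h1 : diameter dist (cluster O i) ≤ ENNReal.ofReal D := by
    refine iSup₂_le fun x hx => iSup₂_le fun y hy => ENNReal.ofReal_le_ofReal ?_
    linarith [Metric.dist_le_diam_of_mem X.finite_toSet.isBounded hx.1 hy.1]
  have h2 : ENNReal.ofReal μ ≤ setDist dist
      ((X : Set (EuclideanSpace ℝ (Fin m))) \ cluster O i) (cluster O i) := by
    refine le_iInf₂ fun x hx => le_iInf₂ fun y hy => ENNReal.ofReal_le_ofReal ?_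
    exact hsep x hx.1 y hy.1 fun h => hx.2 (h ▸ hy)
  calc _ ≤ ENNReal.ofReal (μ / 2 / D) * ENNReal.ofReal D := mul_le_mul_right h1 _
    _ = ENNReal.ofReal (μ / 2) := by
      rw [← ENNReal.ofReal_mul (by positivity), div_mul_cancel₀ _ hD0.ne']
    _ < ENNReal.ofReal μ := (ENNReal.ofReal_lt_ofReal_iff hμ).2 (half_lt_self hμ)
    _ ≤ _ := h2

open Classical in
lemma mem_cluster_needle {a b : Fin k} {j : X} {i : Fin k} {x : EuclideanSpace ℝ (Fin m)} :
    x ∈ cluster (needle a b j) i ↔ x ∈ X ∧ (if x = j then b else a) = i := by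
  simp [cluster, needle, Subtype.ext_iff]

-- Copies of `h` containing most of a ball cut out the cluster of `a`; copies whose complement does
-- so cut out the needle and the empty clusters.
open Classical in
lemma realizedBy_needle {H : Set (Set (EuclideanSpace ℝ (Fin m)))} (hH : NonFractal H)
    (hH' : ClosedUnderAffine H) (hX : ∀ x ∈ X, ‖x‖ = 1) {a b : Fin k} (hab : a ≠ b) (j : X) :
    RealizedBy H (needle a b j) := by
  obtain ⟨h, hh, ⟨c₁, r₁, hr₁, hc₁⟩, c₂, r₂, hr₂, hc₂⟩ := hH
  have hne₁ : h.Nonempty := ⟨c₁, hc₁ (Metric.mem_ball_self hr₁)⟩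
  have hne₂ : hᶜ.Nonempty := ⟨c₂, hc₂ (Metric.mem_ball_self hr₂)⟩
  have himg (f : EuclideanSpace ℝ (Fin m) ≃ᵃ[ℝ] EuclideanSpace ℝ (Fin m)) (x) :
      x ∈ f '' hᶜ ↔ x ∉ f '' h := by
    rw [Set.image_compl_eq f.bijective, Set.mem_compl_iff]
  intro i
  by_cases hia : i = a
  · obtain ⟨f, hf, hf'⟩ := exists_affineEquiv_singling_out hr₁ hc₁ hne₂ X hX j.2
    refine ⟨f '' h, hH' f h hh, Set.ext fun x => ?_⟩
    rw [mem_cluster_needle, hia]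
    refine and_congr_right fun hx => ?_
    by_cases hxj : x = j
    · subst hxj
      simp only [if_true, hab.symm, false_iff]
      exact hf
    · simp only [hxj, if_false, true_iff]
      exact hf' x hx hxj
  by_cases hib : i = b
  · obtain ⟨f, hf, hf'⟩ := exists_affineEquiv_singling_out hr₂ hc₂ (by rwa [compl_compl]) X hX j.2
    refine ⟨f '' h, hH' f h hh, Set.ext fun x => ?_⟩
    rw [mem_cluster_needle, hib]
    refine and_congr_right fun hx => ?_
    by_cases hxj : x = j
    · subst hxj
      simp only [if_true, true_iff]
      rwa [himg, not_not] at hf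
    · simp only [hxj, if_false, hab, false_iff]
      exact (himg f x).1 (hf' x hx hxj)
  -- An empty cluster: move `hᶜ` over the unit ball. The point `2 • j` is just some point outside
  -- that ball.
  · have hd : (1 : ℝ) <
        dist (0 : EuclideanSpace ℝ (Fin m)) ((2 : ℝ) • (j : EuclideanSpace ℝ _)) := by
      rw [dist_zero_left, norm_smul, hX j j.2]
      norm_num
    obtain ⟨f, -, hf⟩ := exists_affineEquiv_closedBall_subset_image hr₂ hc₂
      (by rwa [compl_compl]) one_pos hd
    refine ⟨f '' h, hH' f h hh, Set.ext fun x => ?_⟩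
    rw [mem_cluster_needle]
    refine and_congr_right fun hx => iff_of_false ?_ ?_
    · split_ifs <;> exact Ne.symm ‹_›
    · exact (himg f x).1 (hf (by simp [hX x hx]))

open Classical in
lemma not_hasEuclideanMargin_needle {ε : ℝ} (hε : 0 < ε) {a b : Fin k} (hab : a ≠ b) (j : X)
    (hy : ∃ y ∈ X, y ≠ j ∧ dist (j : EuclideanSpace ℝ (Fin m)) y ≤ ε)
    (huv : ∃ u ∈ X, ∃ v ∈ X, u ≠ j ∧ v ≠ j ∧ dist u v = 2) :
    ¬ HasEuclideanMargin ε (needle a b j) := by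
  obtain ⟨y, hyX, hyj, hjy⟩ := hy
  obtain ⟨u, huX, v, hvX, huj, hvj, huv⟩ := huv
  have hmem {z} (hz : z ∈ X) (hzj : z ≠ j) : z ∈ cluster (needle a b j) a := by
    simp [mem_cluster_needle, hz, hzj]
  have hj : (j : EuclideanSpace ℝ (Fin m)) ∉ cluster (needle a b j) a := by
    simp [mem_cluster_needle, hab.symm]
  intro h
  refine (h a).not_ge ?_
  calc setDist dist ((X : Set (EuclideanSpace ℝ (Fin m))) \ cluster (needle a b j) a)
        (cluster (needle a b j) a) ≤ ENNReal.ofReal (dist (j : EuclideanSpace ℝ (Fin m)) y) :=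
        iInf₂_le_of_le j.1 ⟨j.2, hj⟩ (iInf₂_le_of_le y (hmem hyX hyj) le_rfl)
    _ ≤ ENNReal.ofReal (ε * dist u v) := ENNReal.ofReal_le_ofReal (by rw [huv]; linarith)
    _ = ENNReal.ofReal ε * ENNReal.ofReal (dist u v) := ENNReal.ofReal_mul hε.le
    _ ≤ _ := by
        refine mul_le_mul_right ?_ _
        exact le_iSup₂_of_le u (hmem huX huj) (le_iSup₂_of_le v (hmem hvX hvj) le_rfl)

theorem exists_hard_finset (hm : 2 ≤ m) {H : Set (Set (EuclideanSpace ℝ (Fin m)))}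
    (hH : NonFractal H) (hH' : ClosedUnderAffine H) (hk : 2 ≤ k)
    (A : Algorithm (EuclideanSpace ℝ (Fin m)) k) {p : ℝ} (hp : 0 < p) (N : ℕ) {ε : ℝ}
    (hε : 0 < ε) :
    ∃ X : Finset (EuclideanSpace ℝ (Fin m)), N ≤ X.card ∧
      ((∀ O : X → Fin k, RealizedBy H O → (∃ γ > 0, HasEuclideanMargin γ O) →
          ¬ HasEuclideanMargin ε O → ENNReal.ofReal p ≤ A.successProb X O) →
        ∃ O : X → Fin k, RealizedBy H O ∧ (∃ γ > 0, HasEuclideanMargin γ O) ∧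
          ¬ HasEuclideanMargin ε O ∧
          ENNReal.ofReal (1 / 4 * p * X.card) ≤ A.expectedQueries X O) := by
  classical
  have hrank : 1 < Module.rank ℝ (EuclideanSpace ℝ (Fin m)) := by
    rw [← Module.finrank_eq_rank, finrank_euclideanSpace_fin]
    exact_mod_cast hm
  -- The extra `⌊2 / p⌋₊ + 1` points ensure `2 < p * n`.
  obtain ⟨X, hcard, hX, hpts⟩ := exists_finset_sphere hrank (N + (⌊2 / p⌋₊ + 1)) hε
  have hab : (⟨0, by omega⟩ : Fin k) ≠ ⟨1, by omega⟩ := by simp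
  have hS (j : X) := realizedBy_needle hH hH' hX hab j
  have hM (j : X) := not_hasEuclideanMargin_needle hε hab j (hpts j j.2).1 (hpts j j.2).2
  refine ⟨X, le_trans (Nat.le_add_right _ _) hcard, fun hA => ?_⟩
  have hlarge : 2 < p * X.card := by
    have h1 : ((⌊2 / p⌋₊ + 1 : ℕ) : ℝ) ≤ X.card :=
      Nat.cast_le.2 ((Nat.le_add_left _ _).trans hcard)
    rw [mul_comm, ← div_lt_iff₀ hp]
    exact (Nat.lt_floor_add_one _).trans_le (by exact_mod_cast h1)
  obtain ⟨j, hj⟩ := exists_le_expectedQueries hab A X hp hlarge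
    fun j => hA _ (hS j) (exists_hasEuclideanMargin _) (hM j)
  exact ⟨_, hS j, exists_hasEuclideanMargin _, hM j, hj⟩

end LowerBound

end ClusterRecovery

theorem mainTheorem5 :
    ∃ (K : ℝ → ℝ) (c : ℝ), 0 < c ∧
      ∀ (m : ℕ) (H : Set (Set (EuclideanSpace ℝ (Fin m)))), NonFractal H → ClosedUnderAffine H →
        (∀ (k : ℕ) (γ : ℝ), 0 < γ →
          ∃ A : Algorithm (EuclideanSpace ℝ (Fin m)) k,
            ∀ (X : Finset (EuclideanSpace ℝ (Fin m))) (O : X → Fin k),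
              RealizedBy H O → HasEuclideanMargin γ O →
                A.AlwaysRecovers X O ∧
                ∀ a : ℝ, 0 < a →
                  ENNReal.ofReal (1 - (X.card : ℝ) ^ (-a)) ≤
                    A.probQueriesLE X O
                      (K a * (packingBound m γ * k * Real.log k * Real.log X.card))) ∧
        (2 ≤ m →
          ∀ (k : ℕ), 2 ≤ k →
          ∀ (A : Algorithm (EuclideanSpace ℝ (Fin m)) k) (p : ℝ), 0 < p → p ≤ 1 →
          ∀ (N : ℕ) (ε : ℝ), 0 < ε →
            ∃ X : Finset (EuclideanSpace ℝ (Fin m)), N ≤ X.card ∧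
              ((∀ O : X → Fin k, RealizedBy H O → (∃ γ > 0, HasEuclideanMargin γ O) →
                  ¬ HasEuclideanMargin ε O → ENNReal.ofReal p ≤ A.successProb X O) →
                ∃ O : X → Fin k, RealizedBy H O ∧ (∃ γ > 0, HasEuclideanMargin γ O) ∧
                  ¬ HasEuclideanMargin ε O ∧
                  ENNReal.ofReal (c * p * X.card) ≤ A.expectedQueries X O)) := by
  refine ⟨queryConst, 1 / 4, by norm_num, fun m H hH hH' => ⟨fun k γ hγ => ?_, ?_⟩⟩
  · obtain ⟨A, hA⟩ := exists_algorithm m k hγ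
    exact ⟨A, fun X O _ hO => hA X O hO⟩
  · intro hm k hk A p hp _ N ε hε
    exact exists_hard_finset hm hH hH' hk A hp N hε
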